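/- Let $\mathcal{A}$ be a finite alphabet. For $a\in\mathcal{A}$ let $\psi_a,\overline{\psi}_a:\mathcal{A}^*\to\mathcal{A}^*$ be the monoid morphisms with $\psi_a(a)=\overline{\psi}_a(a)=a$ and $\psi_a(b)=ab$, $\overline{\psi}_a(b)=ba$ for all letters $b\neq a$; for $a,b\in\mathcal{A}$ let $\theta_{ab}$ be the morphism that exchanges the letters $a$ and $b$ and fixes every other letter. An episturmian substitution over $\mathcal{A}$ is an element of the monoid (under composition) generated by all $\psi_a$, $\overline{\psi}_a$ and $\theta_{ab}$. Let $\sigma$ and $\tau$ be two episturmian substitutions over $\mathcal{A}$ such that $\sigma^n=\tau^m$ for some integers $n\geq m\geq 1$. Then there exists an episturmian substitution $\varrho$ over $\mathcal{A}$ such that $\tau=\sigma\circ\varrho$. -/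

import Mathlib

namespace Episturmian

variable {A : Type*} [DecidableEq A]

/-- The substitution `ψ_a`, with `a ↦ a` and `b ↦ ab` for `b ≠ a`.
Words over `A` are elements of `FreeMonoid A`. -/
def psi (a : A) : Monoid.End (FreeMonoid A) :=
  FreeMonoid.lift fun b =>
    if b = a then FreeMonoid.of a else FreeMonoid.of a * FreeMonoid.of b

/-- The substitution `ψ̄_a`, with `a ↦ a` and `b ↦ ba` for `b ≠ a`. -/
def psiBar (a : A) : Monoid.End (FreeMonoid A) :=
  FreeMonoid.lift fun b =>
    if b = a then FreeMonoid.of a else FreeMonoid.of b * FreeMonoid.of a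

/-- The substitution `θ_{ab}` exchanging the letters `a` and `b`. -/
def theta (a b : A) : Monoid.End (FreeMonoid A) :=
  FreeMonoid.map (Equiv.swap a b)

variable (A) in
/-- The monoid (under composition) of episturmian substitutions over `A`, generated by all
`θ_{ab}`, `ψ_a` and `ψ̄_a`. The product of `Monoid.End` is composition. -/
def episturmianMonoid : Submonoid (Monoid.End (FreeMonoid A)) :=
  Submonoid.closure
    ({f | ∃ a b, f = theta a b} ∪ {f | ∃ a, f = psi a} ∪ {f | ∃ a, f = psiBar a})

/-- `σ` is an episturmian substitution over `A`. -/
def IsEpisturmian (σ : Monoid.End (FreeMonoid A)) : Prop :=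
  σ ∈ episturmianMonoid A

end Episturmian

/-! Every episturmian substitution is a conjugate `x ↦ p⁻¹ S(x) p` of a standard one `S = std w π`
by a prefix `p` of `pal w`, and all such conjugates are episturmian
(`IsEpisturmian.exists_isConjBy`, `exists_isEpisturmian_isConjBy`). Over at least two letters `w`,
`π` and `p` are unique (`IsConjBy.eq_of_std`, `IsConjBy.unique`).

Let `σ`, `τ` be given by `(S, p)`, `(T, q)`, with `pal w = p p'` and `pal v = q q'`. By uniqueness
`σ^n = τ^m` yields `S^n = T^m` and `S^(n-1)(p) ⋯ S(p) p = T^(m-1)(q) ⋯ T(q) q`. As `n ≥ m`, `w` is a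
prefix of `v`, so `T = S ∘ Y` with `Y` standard, directed by some `y`. It remains to find a prefix
`t` of `pal y` with `q = S(t) p`: the conjugate of `Y` by `t` is then `ρ`.

Splitting off the last factors gives `S(r) p = S(Y(s)) q`. If `|p| ≤ |q|`, then `r = Y(s) t` and `q
= S(t) p`; if `|p'| ≤ |q'|`, then `t` is a prefix of `pal y`. Both inequalities come from
`IsDirective.length_le_of_orbitWord`: were one to fail, the two sides of an equality between orbit
words would have different lengths. -/

namespace Episturmian

open FreeMonoid

/-! ### Standard substitutions, palindromes and conjugation -/

section

variable {A : Type*}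

theorem end_mul_apply (f g : Monoid.End (FreeMonoid A)) (x : FreeMonoid A) :
    (f * g) x = f (g x) := rfl

/-- Two left divisors of the same word are comparable. -/
theorem dvd_of_dvd_of_length_le {x y z : FreeMonoid A} (hx : x ∣ z) (hy : y ∣ z)
    (h : x.length ≤ y.length) : x ∣ y := by
  obtain ⟨s, rfl⟩ := hx
  obtain ⟨t, ht⟩ := hy
  obtain ⟨u, hu⟩ := List.prefix_of_prefix_length_le (l₁ := x.toList) (l₂ := y.toList)
    (l₃ := (x * s).toList) ⟨s.toList, rfl⟩ ⟨t.toList, by rw [ht]; rfl⟩ h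
  exact ⟨ofList u, hu.symm⟩

theorem eq_of_dvd_of_dvd {x y z : FreeMonoid A} (hx : x ∣ z) (hy : y ∣ z)
    (h : x.length = y.length) : x = y := by
  obtain ⟨u, rfl⟩ := dvd_of_dvd_of_length_le hx hy h.le
  have : u = 1 := by rw [← length_eq_zero]; rw [length_mul] at h; lia
  simp [this]

theorem eq_of_mul_eq_mul_of_length_eq {x y s t : FreeMonoid A} (h : x * s = y * t)
    (hl : x.length = y.length) : x = y :=
  eq_of_dvd_of_dvd ⟨s, rfl⟩ ⟨t, h⟩ hl

theorem dvd_of_iff {x : FreeMonoid A} {a : A} {z : FreeMonoid A} :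
    x ∣ of a * z ↔ x = 1 ∨ ∃ y, x = of a * y ∧ y ∣ z := by
  constructor
  · intro h
    cases x using FreeMonoid.casesOn with
    | one => exact Or.inl rfl
    | of_mul b y =>
      right
      obtain ⟨c, hc⟩ := h
      rw [mul_assoc] at hc
      have hab : of a = of b := eq_of_mul_eq_mul_of_length_eq hc rfl
      rw [hab] at hc ⊢
      exact ⟨y, rfl, c, mul_left_cancel hc⟩
  · rintro (rfl | ⟨y, rfl, c, rfl⟩)
    · exact one_dvd _
    · exact ⟨c, by rw [mul_assoc]⟩

/-- A permutation of the letters, as an endomorphism. -/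
def perm (π : Equiv.Perm A) : Monoid.End (FreeMonoid A) := FreeMonoid.map π

@[simp] theorem perm_of (π : Equiv.Perm A) (a : A) : perm π (of a) = of (π a) := rfl

theorem perm_mul (π κ : Equiv.Perm A) : perm (π * κ) = perm π * perm κ :=
  FreeMonoid.hom_eq fun _ => rfl

@[simp] theorem perm_one : perm (1 : Equiv.Perm A) = 1 :=
  FreeMonoid.hom_eq fun _ => rfl

@[simp] theorem length_perm (π : Equiv.Perm A) (x : FreeMonoid A) :
    (perm π x).length = x.length := List.length_map _

theorem perm_injective (π : Equiv.Perm A) : Function.Injective (perm π) :=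
  List.map_injective_iff.2 π.injective

/-- `σ` is the conjugate of `S` by `p`, that is, `σ x = p⁻¹ (S x) p`. -/
def IsConjBy (p : FreeMonoid A) (S σ : Monoid.End (FreeMonoid A)) : Prop :=
  ∀ x, p * σ x = S x * p

theorem IsConjBy.mul {p q : FreeMonoid A} {S T σ τ : Monoid.End (FreeMonoid A)}
    (hσ : IsConjBy p S σ) (hτ : IsConjBy q T τ) : IsConjBy (S q * p) (S * T) (σ * τ) := by
  intro x
  rw [end_mul_apply, end_mul_apply, mul_assoc, hσ, ← mul_assoc, ← map_mul, hτ, map_mul, mul_assoc]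

theorem isConjBy_refl (S : Monoid.End (FreeMonoid A)) : IsConjBy 1 S S := fun x => by simp

variable [DecidableEq A]

theorem psi_of (a b : A) : psi a (of b) = if b = a then of a else of a * of b :=
  FreeMonoid.lift_eval_of _ _

theorem psiBar_of (a b : A) : psiBar a (of b) = if b = a then of a else of b * of a :=
  FreeMonoid.lift_eval_of _ _

theorem of_mul_psiBar (a : A) (x : FreeMonoid A) : of a * psiBar a x = psi a x * of a := by
  induction x using FreeMonoid.inductionOn' with
  | one => simp
  | of_mul b x ih =>
    rw [map_mul, map_mul, mul_assoc, ← ih, psi_of, psiBar_of]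
    split_ifs <;> simp [mul_assoc]

theorem perm_psi (π : Equiv.Perm A) (a : A) : perm π * psi a = psi (π a) * perm π :=
  FreeMonoid.hom_eq fun b => by
    change perm π (psi a (of b)) = psi (π a) (perm π (of b))
    rw [perm_of, psi_of, psi_of]
    simp only [EmbeddingLike.apply_eq_iff_eq]
    split_ifs <;> simp

theorem psi_injective (a : A) : Function.Injective (psi a) := by
  intro x
  induction x using FreeMonoid.inductionOn' with
  | one =>
    intro y h
    cases y using FreeMonoid.casesOn with
    | one => rfl
    | of_mul b y =>
      have := congrArg FreeMonoid.length h
      rw [map_mul, map_one, psi_of] at this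
      split_ifs at this <;> simp only [length_mul, length_of, length_one] at this <;> lia
  | of_mul b x ih =>
    intro y h
    cases y using FreeMonoid.casesOn with
    | one =>
      have := congrArg FreeMonoid.length h
      rw [map_mul, map_one, psi_of] at this
      split_ifs at this <;> simp only [length_mul, length_of, length_one] at this <;> lia
    | of_mul c y =>
      have key : ∀ (d : A) (u v : FreeMonoid A), d ≠ a → of d * u = psi a v → False := by
        intro d u v hd e
        cases v using FreeMonoid.casesOn with
        | one => simpa using congrArg FreeMonoid.length e
        | of_mul c v =>
          have : of d = of a := by
            rw [map_mul, psi_of] at e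
            split_ifs at e
            · exact eq_of_mul_eq_mul_of_length_eq e rfl
            · rw [mul_assoc] at e
              exact eq_of_mul_eq_mul_of_length_eq e rfl
          exact hd (of_injective this)
      rw [map_mul, map_mul, psi_of, psi_of] at h
      split_ifs at h with hb hc hc
      · rw [ih (mul_left_cancel h), hb, hc]
      · rw [mul_assoc] at h
        exact (key _ _ _ hc (mul_left_cancel h).symm).elim
      · rw [mul_assoc] at h
        exact (key _ _ _ hb (mul_left_cancel h)).elim
      · rw [mul_assoc, mul_assoc] at h
        have h := mul_left_cancel h
        have e : of b = of c := eq_of_mul_eq_mul_of_length_eq h rfl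
        rw [e] at h ⊢
        rw [ih (mul_left_cancel h)]

/-- The standard substitution directed by a word. -/
def psiWord (w : List A) : Monoid.End (FreeMonoid A) := (w.map psi).prod

@[simp] theorem psiWord_nil : psiWord ([] : List A) = 1 := rfl

theorem psiWord_cons (a : A) (w : List A) : psiWord (a :: w) = psi a * psiWord w :=
  List.prod_cons

theorem psiWord_append (w v : List A) : psiWord (w ++ v) = psiWord w * psiWord v := by
  simp [psiWord]

theorem perm_psiWord (π : Equiv.Perm A) (w : List A) :
    perm π * psiWord w = psiWord (w.map π) * perm π := by
  induction w with
  | nil => simp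
  | cons a w ih =>
    rw [List.map_cons, psiWord_cons, psiWord_cons, ← mul_assoc, perm_psi, mul_assoc, ih, mul_assoc]

theorem psiWord_injective (w : List A) : Function.Injective (psiWord w) := by
  induction w with
  | nil => exact fun _ _ h => h
  | cons a w ih =>
    rw [psiWord_cons]
    exact (psi_injective a).comp ih

/-- The standard episturmian substitution with directive word `w` and permutation `π`. -/
def std (w : List A) (π : Equiv.Perm A) : Monoid.End (FreeMonoid A) := psiWord w * perm π

theorem std_apply (w : List A) (π : Equiv.Perm A) (x : FreeMonoid A) :
    std w π x = psiWord w (perm π x) := rfl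

theorem std_cons (a : A) (w : List A) (π : Equiv.Perm A) : std (a :: w) π = psi a * std w π := by
  rw [std, psiWord_cons, mul_assoc, std]

theorem std_mul (w v : List A) (π κ : Equiv.Perm A) :
    std w π * std v κ = std (w ++ v.map π) (π * κ) := by
  rw [std, std, std, psiWord_append, perm_mul, mul_assoc, ← mul_assoc (perm π), perm_psiWord]
  simp only [mul_assoc]

theorem std_injective (w : List A) (π : Equiv.Perm A) : Function.Injective (std w π) :=
  (psiWord_injective w).comp (perm_injective π)

theorem length_le_length_psi (a : A) (x : FreeMonoid A) : x.length ≤ (psi a x).length := by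
  induction x using FreeMonoid.inductionOn' with
  | one => simp
  | of_mul b x ih =>
    rw [map_mul, length_mul, length_mul, psi_of]
    split_ifs <;> simp <;> lia

theorem length_le_length_std (w : List A) (π : Equiv.Perm A) (x : FreeMonoid A) :
    x.length ≤ (std w π x).length := by
  induction w with
  | nil => simp [std_apply]
  | cons a w ih => rw [std_cons]; exact ih.trans (length_le_length_psi a _)

/-- The epistandard palindromic word directed by `w`; its prefixes index the conjugates of
`psiWord w`. -/
def pal : List A → FreeMonoid A
  | [] => 1
  | a :: w => psi a (pal w) * of a

@[simp] theorem pal_nil : pal ([] : List A) = 1 := rfl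

theorem pal_cons (a : A) (w : List A) : pal (a :: w) = psi a (pal w) * of a := rfl

theorem pal_append (w v : List A) : pal (w ++ v) = psiWord w (pal v) * pal w := by
  induction w with
  | nil => simp
  | cons a w ih =>
    rw [List.cons_append, pal_cons, ih, map_mul, psiWord_cons, pal_cons, mul_assoc]
    rfl

theorem perm_pal (π : Equiv.Perm A) (w : List A) : perm π (pal w) = pal (w.map π) := by
  induction w with
  | nil => simp
  | cons a w ih =>
    rw [pal_cons, map_mul, ← end_mul_apply, perm_psi, end_mul_apply, ih]
    rfl

theorem pal_append_map (w v : List A) (π : Equiv.Perm A) :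
    pal (w ++ v.map π) = std w π (pal v) * pal w := by
  rw [pal_append, ← perm_pal, std_apply]

/-- Conjugation by `pal w` turns each `psi a` into `psiBar a`, because `psi a x * of a = of a *
psiBar a x`. -/
theorem pal_dvd_psiWord_mul (w : List A) (x : FreeMonoid A) : pal w ∣ psiWord w x * pal w := by
  induction w with
  | nil => simp
  | cons a w ih =>
    obtain ⟨t, ht⟩ := ih
    refine ⟨psiBar a t, ?_⟩
    rw [pal_cons, psiWord_cons, ← mul_assoc, end_mul_apply, ← map_mul, ht, map_mul, mul_assoc,
      mul_assoc, of_mul_psiBar]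

theorem pal_dvd_pal_append (w v : List A) : pal w ∣ pal (w ++ v) := by
  rw [pal_append]
  exact pal_dvd_psiWord_mul _ _

theorem std_mul_dvd_pal {w v : List A} (π : Equiv.Perm A) {p s : FreeMonoid A} (hp : p ∣ pal w)
    (hs : s ∣ pal v) : std w π s * p ∣ pal (w ++ v.map π) := by
  obtain ⟨t, ht⟩ := hs
  rw [pal_append_map, ht, map_mul, mul_assoc]
  exact mul_dvd_mul_left _ (hp.trans (pal_dvd_psiWord_mul w (perm π t)))

theorem mem_psi {a b : A} {x : FreeMonoid A} (h : b ∈ (psi a x).toList) :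
    b = a ∨ b ∈ x.toList := by
  induction x using FreeMonoid.inductionOn' with
  | one => exact Or.inr h
  | of_mul c x ih =>
    rw [map_mul, toList_mul, List.mem_append, psi_of] at h
    rw [toList_mul, List.mem_append]
    split_ifs at h with hc <;>
      simp only [List.mem_append, toList_of, toList_mul, List.mem_singleton] at h ⊢ <;> tauto

theorem mem_psiWord {w : List A} {b : A} {x : FreeMonoid A} (h : b ∈ (psiWord w x).toList) :
    b ∈ w ∨ b ∈ x.toList := by
  induction w with
  | nil => exact Or.inr h
  | cons a w ih =>
    rw [psiWord_cons] at h
    rcases mem_psi h with h | h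
    · simp [h]
    · exact (ih h).imp_left (List.mem_cons_of_mem _)

theorem mem_pal {w : List A} {b : A} (h : b ∈ (pal w).toList) : b ∈ w := by
  induction w with
  | nil => exact absurd h List.not_mem_nil
  | cons a w ih =>
    rw [pal_cons, toList_mul, List.mem_append] at h
    rcases h with h | h
    · rcases mem_psi h with h | h
      · simp [h]
      · exact List.mem_cons_of_mem _ (ih h)
    · simp_all

/-- The image under `psi a` consists of blocks `a` and `ab`. A cut falls between blocks or just
after the `a` of a block `ab`; the final `a` behaves like such a half block. -/
theorem dvd_psi_mul {a : A} {p z : FreeMonoid A} (h : p ∣ psi a z * of a) :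
    ∃ q, q ∣ z ∧ (p = psi a q ∨ p = psi a q * of a) := by
  induction z using FreeMonoid.inductionOn' generalizing p with
  | one =>
    rw [map_one, one_mul, ← mul_one (of a), dvd_of_iff] at h
    obtain rfl | ⟨y, rfl, hy⟩ := h
    · exact ⟨1, one_dvd _, by simp⟩
    · obtain ⟨c, hc⟩ := hy
      have : y = 1 := by
        have := congrArg FreeMonoid.length hc
        rw [length_mul, length_one] at this
        rw [← length_eq_zero]; lia
      exact ⟨1, one_dvd _, by simp [this]⟩
  | of_mul b z ih =>
    have lift : ∀ y, y ∣ psi a z * of a → ∃ q, q ∣ of b * z ∧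
        (psi a (of b) * y = psi a q ∨ psi a (of b) * y = psi a q * of a) := by
      intro y hy
      obtain ⟨q, hq, h⟩ := ih hy
      refine ⟨of b * q, mul_dvd_mul_left _ hq, ?_⟩
      rcases h with rfl | rfl <;> simp [map_mul, mul_assoc]
    rw [map_mul, mul_assoc, psi_of] at h
    rw [psi_of] at lift
    split_ifs at h lift
    · rw [dvd_of_iff] at h
      obtain rfl | ⟨y, rfl, hy⟩ := h
      · exact ⟨1, one_dvd _, by simp⟩
      · exact lift y hy
    · rw [mul_assoc, dvd_of_iff] at h
      obtain rfl | ⟨y, rfl, hy⟩ := h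
      · exact ⟨1, one_dvd _, by simp⟩
      rw [dvd_of_iff] at hy
      obtain rfl | ⟨y, rfl, hy⟩ := hy
      · exact ⟨1, one_dvd _, by simp⟩
      · simpa only [mul_assoc] using lift y hy

theorem isConjBy_psiBar (a : A) : IsConjBy (of a) (psi a) (psiBar a) := of_mul_psiBar a

theorem IsEpisturmian.exists_isConjBy {σ : Monoid.End (FreeMonoid A)} (h : IsEpisturmian σ) :
    ∃ w π p, p ∣ pal w ∧ IsConjBy p (std w π) σ := by
  induction h using Submonoid.closure_induction_left with
  | one => exact ⟨[], 1, 1, one_dvd _, by simpa [std] using isConjBy_refl 1⟩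
  | mul_left f hf σ _ ih =>
    obtain ⟨w, π, p, hp, hσ⟩ := ih
    rcases hf with (⟨a, b, rfl⟩ | ⟨a, rfl⟩) | ⟨a, rfl⟩
    · have := std_mul_dvd_pal (w := []) (Equiv.swap a b) (one_dvd _) hp
      have h2 := (isConjBy_refl (std [] (Equiv.swap a b))).mul hσ
      rw [std_mul] at h2
      exact ⟨_, _, _, this, h2⟩
    · have := std_mul_dvd_pal (w := [a]) 1 (one_dvd _) hp
      have h2 := (isConjBy_refl (std [a] 1)).mul hσ
      rw [std_mul] at h2
      rw [show std [a] 1 = psi a by simp [std, psiWord]] at h2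
      rw [show std [a] 1 = psi a by simp [std, psiWord]] at this
      exact ⟨_, _, _, this, h2⟩
    · have := std_mul_dvd_pal (w := [a]) (p := of a) 1 (by simp [pal_cons]) hp
      have h2 := (isConjBy_psiBar a).mul hσ
      rw [show psi a = std [a] 1 by simp [std, psiWord], std_mul] at h2
      exact ⟨_, _, _, this, h2⟩

theorem isEpisturmian_perm [Finite A] (π : Equiv.Perm A) : IsEpisturmian (perm π) := by
  induction π using Equiv.Perm.swap_induction_on with
  | one => rw [perm_one]; exact one_mem _
  | swap_mul f x y _ ih =>
    rw [perm_mul]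
    exact mul_mem (Submonoid.subset_closure (Or.inl (Or.inl ⟨x, y, rfl⟩))) ih

/-- The two shapes of a prefix in `dvd_psi_mul` decide, letter by letter, between `psi a` and
`psiBar a`. -/
theorem exists_isEpisturmian_isConjBy [Finite A] {w : List A} (π : Equiv.Perm A)
    {p : FreeMonoid A} (hp : p ∣ pal w) :
    ∃ ρ, IsEpisturmian ρ ∧ IsConjBy p (std w π) ρ := by
  induction w generalizing p with
  | nil =>
    obtain ⟨c, hc⟩ := hp
    have : p = 1 := by
      have := congrArg FreeMonoid.length hc
      rw [length_mul, pal_nil, length_one] at this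
      rw [← length_eq_zero]; lia
    subst this
    exact ⟨perm π, isEpisturmian_perm π, isConjBy_refl _⟩
  | cons a w ih =>
    obtain ⟨q, hq, h⟩ := dvd_psi_mul hp
    obtain ⟨ρ, hρ, hc⟩ := ih hq
    rcases h with rfl | rfl
    · refine ⟨psi a * ρ, mul_mem (Submonoid.subset_closure (Or.inl (Or.inr ⟨a, rfl⟩))) hρ, ?_⟩
      rw [std_cons]
      simpa using (isConjBy_refl (psi a)).mul hc
    · refine ⟨psiBar a * ρ, mul_mem (Submonoid.subset_closure (Or.inr ⟨a, rfl⟩)) hρ, ?_⟩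
      rw [std_cons]
      exact (isConjBy_psiBar a).mul hc

end

/-! ### Uniqueness of the standard form and of the conjugating word -/

section

variable {A : Type*}

theorem of_mul_of_comm {a b : A} (h : of a * of b = of b * of a) : a = b :=
  of_injective (eq_of_mul_eq_mul_of_length_eq h rfl)

theorem length_pow (x : FreeMonoid A) (n : ℕ) : (x ^ n).length = n * x.length := by
  induction n with
  | zero => simp
  | succ n ih => rw [pow_succ, length_mul, ih]; ring

theorem pow_length_eq_of_commute {x y : FreeMonoid A} (h : Commute x y) :
    x ^ y.length = y ^ x.length :=
  eq_of_mul_eq_mul_of_length_eq (h.pow_pow y.length x.length)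
    (by rw [length_pow, length_pow, mul_comm])

/-- Words commuting with a nonempty `e` share powers with it, so `φ` would identify a power of `a`
with a power of `b`. -/
theorem eq_one_of_commute_range [Nontrivial A] {φ : Monoid.End (FreeMonoid A)}
    (hφ : Function.Injective φ) {e : FreeMonoid A} (he : ∀ x, Commute e (φ x)) : e = 1 := by
  obtain ⟨a, b, hab⟩ := exists_pair_ne A
  by_contra h1
  have he0 : 0 < e.length := Nat.pos_of_ne_zero fun h => h1 (length_eq_zero.1 h)
  have hpos : ∀ c : A, 0 < (φ (of c)).length := fun c => Nat.pos_of_ne_zero fun h => by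
    have h := length_eq_zero.1 h
    rw [← map_one φ] at h
    exact of_ne_one c (hφ h)
  have ha := pow_length_eq_of_commute (he (of a))
  have hb := pow_length_eq_of_commute (he (of b))
  have key : φ (of a ^ (e.length * (φ (of b)).length)) =
      φ (of b ^ (e.length * (φ (of a)).length)) := by
    rw [map_pow, map_pow, pow_mul, pow_mul, ← ha, ← hb, ← pow_mul, ← pow_mul, mul_comm]
  have key := hφ key
  obtain ⟨k, hk⟩ := Nat.exists_eq_succ_of_ne_zero (Nat.mul_pos he0 (hpos b)).ne'
  obtain ⟨l, hl⟩ := Nat.exists_eq_succ_of_ne_zero (Nat.mul_pos he0 (hpos a)).ne'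
  rw [hk, hl, Nat.succ_eq_add_one, Nat.succ_eq_add_one, pow_succ', pow_succ'] at key
  exact hab (of_injective (eq_of_mul_eq_mul_of_length_eq key rfl))

/-- Along the prefixes of a word, conjugating words are determined by the conjugate. -/
theorem IsConjBy.unique [Nontrivial A] {p q z : FreeMonoid A}
    {S φ : Monoid.End (FreeMonoid A)} (hS : Function.Injective S) (hp : IsConjBy p S φ)
    (hq : IsConjBy q S φ) (hpz : p ∣ z) (hqz : q ∣ z) : p = q := by
  wlog h : p.length ≤ q.length generalizing p q
  · exact (this hq hp hqz hpz (by lia)).symm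
  obtain ⟨e, rfl⟩ := dvd_of_dvd_of_length_le hpz hqz h
  have hφ : Function.Injective φ := fun x y hxy => hS <| mul_right_cancel (b := p) <| by
    rw [← hp, ← hp, hxy]
  have : e = 1 := eq_one_of_commute_range hφ fun x => mul_left_cancel (a := p) <| by
    rw [← mul_assoc, hq, ← mul_assoc, ← hp, mul_assoc]
  rw [this, mul_one]

variable [DecidableEq A]

theorem not_forall_count_eq_length [Nontrivial A] {f : Monoid.End (FreeMonoid A)}
    (hf : Function.Injective f) (b : A) :
    ¬ ∀ x, (f x).toList.count b = (f x).length := by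
  intro h
  obtain ⟨x, y, hxy⟩ := exists_pair_ne A
  have rep : ∀ z, (f z).toList = List.replicate (f z).length b := fun z =>
    List.eq_replicate_iff.2 ⟨rfl, fun c hc => (List.count_eq_length.1 (h z) c hc).symm⟩
  apply hxy
  apply of_mul_of_comm
  apply hf
  apply toList.injective
  rw [rep, rep, map_mul, map_mul, length_mul, length_mul, Nat.add_comm]

theorem count_psi_self (a : A) (x : FreeMonoid A) : (psi a x).toList.count a = x.length := by
  induction x using FreeMonoid.inductionOn' with
  | one => simp
  | of_mul b x ih =>
    rw [map_mul, toList_mul, List.count_append, ih, length_mul, length_of, psi_of]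
    split_ifs with h
    · simp
    · simp [h, toList_mul]

theorem count_psi_of_ne {a b : A} (h : b ≠ a) (x : FreeMonoid A) :
    (psi a x).toList.count b = x.toList.count b := by
  induction x using FreeMonoid.inductionOn' with
  | one => simp
  | of_mul c x ih =>
    rw [map_mul, toList_mul, List.count_append, ih, toList_mul, List.count_append, psi_of]
    split_ifs with hc
    · rw [hc]
    · simp [List.count_cons, h.symm]

theorem length_psi_add_count (a : A) (x : FreeMonoid A) :
    (psi a x).length + x.toList.count a = 2 * x.length := by
  induction x using FreeMonoid.inductionOn' with
  | one => simp
  | of_mul b x ih =>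
    rw [map_mul, toList_mul, List.count_append, length_mul, length_mul, psi_of]
    split_ifs with h
    · simp [h]; lia
    · simp [h]; lia

/-- A standard episturmian substitution over at least two letters is determined by its incidence
matrix, and it determines its directive word and its permutation. -/
theorem eq_of_std_perm [Nontrivial A] {w v : List A} {π κ : Equiv.Perm A}
    (h : ∀ x, (std w π x).toList.Perm (std v κ x).toList) : w = v ∧ π = κ := by
  have nil_cons : ∀ (b : A) (v : List A) (π κ : Equiv.Perm A),
      ¬ ∀ x, (std [] π x).toList.Perm (std (b :: v) κ x).toList := by
    intro b v π κ h
    have hlen : ∀ c : A, (std v κ (of c)).toList.count b = (std v κ (of c)).length := by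
      intro c
      have h1 : 1 = (psi b (std v κ (of c))).length := by
        have := (h (of c)).length_eq
        rwa [std_cons] at this
      have h2 := length_psi_add_count b (std v κ (of c))
      have h3 := length_le_length_std v κ (of c)
      have h4 : (std v κ (of c)).toList.count b ≤ (std v κ (of c)).length := List.count_le_length
      rw [length_of] at h3
      lia
    refine not_forall_count_eq_length (std_injective v κ) b fun x => ?_
    induction x using FreeMonoid.inductionOn' with
    | one => simp
    | of_mul c x ih => rw [map_mul, toList_mul, List.count_append, length_mul, ih, hlen]
  induction w generalizing v with
  | nil =>
    cases v with
    | cons b v => exact (nil_cons _ _ _ _ h).elim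
    | nil =>
      refine ⟨rfl, Equiv.ext fun a => ?_⟩
      simpa [std] using h (of a)
  | cons a w ih =>
    cases v with
    | nil => exact (nil_cons _ _ _ _ fun x => (h x).symm).elim
    | cons b v =>
      have hc : ∀ x c, (psi a (std w π x)).toList.count c = (psi b (std v κ x)).toList.count c :=
        fun x c => by
          have := (h x).count_eq c
          rwa [std_cons, std_cons] at this
      by_cases hab : a = b
      · subst hab
        have hl : ∀ x, (std w π x).length = (std v κ x).length := fun x => by
          rw [← count_psi_self a, hc, count_psi_self]
        obtain ⟨rfl, rfl⟩ := ih (v := v) fun x => List.perm_iff_count.2 fun c => by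
          by_cases hca : c = a
          · subst hca
            have h0 : (psi c (std w π x)).length = (psi c (std v κ x)).length := by
              have := (h x).length_eq
              rwa [std_cons, std_cons] at this
            have h1 := length_psi_add_count c (std w π x)
            have h2 := length_psi_add_count c (std v κ x)
            have h3 := hl x
            lia
          · rw [← count_psi_of_ne hca, hc, count_psi_of_ne hca]
        exact ⟨rfl, rfl⟩
      -- With distinct first letters, `|Sx|` is the number of `a` in `Tx` and `|Tx|` the number of
      -- `b` in `Sx`, for the remaining `S`, `T`. Hence `Sx` is a power of `b` for every `x`,
      -- against injectivity.
      · refine (not_forall_count_eq_length (std_injective w π) b fun x => ?_).elim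
        have h1 := hc x a
        have h2 := hc x b
        rw [count_psi_self, count_psi_of_ne hab] at h1
        rw [count_psi_self, count_psi_of_ne (Ne.symm hab)] at h2
        have h3 : (std w π x).toList.count b ≤ (std w π x).length := List.count_le_length
        have h4 : (std v κ x).toList.count a ≤ (std v κ x).length := List.count_le_length
        lia

theorem IsConjBy.eq_of_std [Nontrivial A] {w v : List A} {π κ : Equiv.Perm A}
    {p q : FreeMonoid A} {φ : Monoid.End (FreeMonoid A)} (hp : IsConjBy p (std w π) φ)
    (hq : IsConjBy q (std v κ) φ) : w = v ∧ π = κ := by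
  have key : ∀ {w : List A} {π : Equiv.Perm A} {p : FreeMonoid A}, IsConjBy p (std w π) φ →
      ∀ x, (std w π x).toList.Perm (φ x).toList := by
    intro w π p hp x
    have h : p.toList ++ (φ x).toList = (std w π x).toList ++ p.toList := congrArg toList (hp x)
    exact (List.perm_append_right_iff p.toList).1 (h ▸ List.perm_append_comm)
  exact eq_of_std_perm fun x => (key hp x).trans (key hq x).symm

end

/-! ### Powers and their directive words -/

section

variable {A : Type*}

/-- The word `S^(k-1)(p) ⋯ S(p) p`, by which `σ ^ k` is conjugate to `S ^ k` when `σ` is conjugate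
to `S` by `p`. -/
def orbitWord (S : Monoid.End (FreeMonoid A)) (p : FreeMonoid A) : ℕ → FreeMonoid A
  | 0 => 1
  | k + 1 => S (orbitWord S p k) * p

theorem IsConjBy.pow {p : FreeMonoid A} {S σ : Monoid.End (FreeMonoid A)} (h : IsConjBy p S σ)
    (k : ℕ) : IsConjBy (orbitWord S p k) (S ^ k) (σ ^ k) := by
  induction k with
  | zero => exact isConjBy_refl 1
  | succ k ih => rw [pow_succ', pow_succ']; exact h.mul ih

theorem orbitWord_succ' (S : Monoid.End (FreeMonoid A)) (p : FreeMonoid A) (k : ℕ) :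
    orbitWord S p (k + 1) = (S ^ k) p * orbitWord S p k := by
  induction k with
  | zero => simp [orbitWord]
  | succ k ih =>
    conv_lhs => rw [orbitWord, ih, map_mul, mul_assoc]
    rw [pow_succ']
    rfl

theorem length_orbitWord (S : Monoid.End (FreeMonoid A)) (p : FreeMonoid A) (k : ℕ) :
    (orbitWord S p k).length = ∑ i ∈ Finset.range k, ((S ^ i) p).length := by
  induction k with
  | zero => rfl
  | succ k ih => rw [orbitWord_succ', length_mul, ih, Finset.sum_range_succ, add_comm]

/-- The word directing the `k`-th power of `std w π`. -/
def powWord (w : List A) (π : Equiv.Perm A) : ℕ → List A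
  | 0 => []
  | k + 1 => w ++ (powWord w π k).map π

theorem length_powWord (w : List A) (π : Equiv.Perm A) (k : ℕ) :
    (powWord w π k).length = k * w.length := by
  induction k with
  | zero => simp [powWord]
  | succ k ih => simp [powWord, ih]; ring

/-- The infinite word `W = w π(w) π²(w) ⋯`. -/
structure IsDirective (W : ℕ → A) (w : List A) (π : Equiv.Perm A) : Prop where
  map_range : (List.range w.length).map W = w
  apply_add : ∀ i, W (w.length + i) = π (W i)

theorem exists_isDirective {w : List A} (hw : w ≠ []) (π : Equiv.Perm A) :
    ∃ W, IsDirective W w π := by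
  have h : 0 < w.length := List.length_pos_iff.2 hw
  refine ⟨fun i => (π ^ (i / w.length)) (w[i % w.length]'(Nat.mod_lt _ h)), ?_, fun i => ?_⟩
  · refine List.ext_getElem (by simp) fun i h1 h2 => ?_
    simp [Nat.div_eq_of_lt h2, Nat.mod_eq_of_lt h2]
  · simp only [Nat.add_div_left i h, Nat.add_mod_left, pow_succ', Equiv.Perm.mul_apply]

namespace IsDirective

variable {W : ℕ → A} {w v : List A} {π κ : Equiv.Perm A}

theorem map_range_add (h : IsDirective W w π) (k : ℕ) :
    (List.range (w.length + k)).map W = w ++ ((List.range k).map W).map π := by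
  rw [List.range_add, List.map_append, h.map_range, List.map_map, List.map_map]
  congr 1
  exact List.map_congr_left fun i _ => h.apply_add i

theorem powWord_eq (h : IsDirective W w π) (k : ℕ) :
    powWord w π k = (List.range (k * w.length)).map W := by
  induction k with
  | zero => simp [powWord]
  | succ k ih => rw [powWord, ih, ← h.map_range_add, add_mul, one_mul, add_comm]

theorem mem_range (h : IsDirective W w π) {a : A} (ha : a ∈ w) : a ∈ Set.range W := by
  rw [← h.map_range, List.mem_map] at ha
  obtain ⟨i, _, rfl⟩ := ha
  exact ⟨i, rfl⟩

/-- Both sides are the letter of `W` at position `|w| + |v| + i`. Nothing is claimed about letters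
absent from `W`, hence the restriction on letters in what follows. -/
theorem perm_comm (hw : IsDirective W w π) (hv : IsDirective W v κ) (i : ℕ) :
    π (κ (W i)) = κ (π (W i)) := by
  rw [← hw.apply_add, ← hv.apply_add, ← hw.apply_add, ← hv.apply_add, Nat.add_left_comm]

theorem append_comm (hw : IsDirective W w π) (hv : IsDirective W v κ) :
    w ++ v.map π = v ++ w.map κ := by
  conv_lhs => rw [← hv.map_range]
  conv_rhs => rw [← hw.map_range]
  rw [← hw.map_range_add, ← hv.map_range_add, Nat.add_comm]

theorem eq_of_powWord {V : ℕ → A} {n m : ℕ} (hw : IsDirective W w π) (hv : IsDirective V v κ)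
    (hn : 0 < n * w.length) (h : ∀ k, powWord w π (n * k) = powWord v κ (m * k)) : W = V := by
  funext i
  have hi := h (i + 1)
  have hl := congrArg List.length hi
  rw [length_powWord, length_powWord] at hl
  rw [hw.powWord_eq, hv.powWord_eq, ← hl, List.map_inj_left] at hi
  exact hi i (List.mem_range.2 (by nlinarith))

end IsDirective

theorem pow_apply_comm {Q : FreeMonoid A → Prop} {f g : Monoid.End (FreeMonoid A)}
    (hf : ∀ x, Q x → Q (f x)) (hfg : ∀ x, Q x → f (g x) = g (f x)) (n : ℕ) (x : FreeMonoid A)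
    (hx : Q x) : (f ^ n) (g x) = g ((f ^ n) x) := by
  induction n generalizing x with
  | zero => rfl
  | succ n ih =>
    rw [pow_succ, end_mul_apply, end_mul_apply, hfg x hx, ih _ (hf x hx)]

variable [DecidableEq A]

theorem std_pow (w : List A) (π : Equiv.Perm A) (k : ℕ) :
    std w π ^ k = std (powWord w π k) (π ^ k) := by
  induction k with
  | zero => simp [powWord, std]
  | succ k ih => rw [pow_succ', ih, std_mul, powWord, pow_succ']

theorem eq_of_std_eq [Nontrivial A] {w v : List A} {π κ : Equiv.Perm A}
    (h : std w π = std v κ) : w = v ∧ π = κ :=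
  eq_of_std_perm fun x => by rw [h]

theorem orbitWord_dvd_pal {w : List A} (π : Equiv.Perm A) {p : FreeMonoid A} (hp : p ∣ pal w)
    (k : ℕ) : orbitWord (std w π) p k ∣ pal (powWord w π k) := by
  induction k with
  | zero => exact one_dvd _
  | succ k ih => exact std_mul_dvd_pal π hp ih

theorem pal_powWord (w : List A) (π : Equiv.Perm A) (k : ℕ) :
    pal (powWord w π k) = orbitWord (std w π) (pal w) k := by
  induction k with
  | zero => rfl
  | succ k ih => rw [powWord, pal_append_map, ih, orbitWord]

theorem exists_std_factor {w v : List A} (h : v <+: w) (π κ : Equiv.Perm A) :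
    ∃ y μ, w = v ++ y.map κ ∧ std w π = std v κ * std y μ := by
  obtain ⟨r, rfl⟩ := h
  refine ⟨r.map (κ⁻¹ : Equiv.Perm A), κ⁻¹ * π, ?_, ?_⟩
  · simp
  · rw [std_mul]
    simp [List.map_map]

theorem dvd_of_dvd_of_length_std_le {w : List A} {π : Equiv.Perm A} {x y z : FreeMonoid A}
    (hx : x ∣ z) (hy : y ∣ z) (h : (std w π x).length ≤ (std w π y).length) : x ∣ y := by
  by_cases hl : x.length ≤ y.length
  · exact dvd_of_dvd_of_length_le hx hy hl
  · obtain ⟨t, rfl⟩ := dvd_of_dvd_of_length_le hy hx (by lia)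
    have := length_le_length_std w π t
    rw [map_mul, length_mul] at h
    rw [length_mul] at hl
    lia

theorem length_pow_std_pos (w : List A) (π : Equiv.Perm A) (k : ℕ) {x : FreeMonoid A}
    (hx : 0 < x.length) : 0 < ((std w π ^ k) x).length := by
  rw [std_pow]
  exact hx.trans_le (length_le_length_std _ _ _)

/-! ### Comparison of lengths along a common directive word -/

namespace IsDirective

variable {W : ℕ → A} {w v : List A} {π κ : Equiv.Perm A}

theorem std_mem_range (h : IsDirective W w π) {x : FreeMonoid A}
    (hx : ∀ a ∈ x.toList, a ∈ Set.range W) : ∀ a ∈ (std w π x).toList, a ∈ Set.range W := by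
  intro a ha
  rcases mem_psiWord ha with ha | ha
  · exact h.mem_range ha
  · obtain ⟨b, hb, rfl⟩ := List.mem_map.1 ha
    obtain ⟨i, rfl⟩ := hx b hb
    exact ⟨_, h.apply_add i⟩

theorem std_comm (hw : IsDirective W w π) (hv : IsDirective W v κ) {x : FreeMonoid A}
    (hx : ∀ a ∈ x.toList, a ∈ Set.range W) :
    std w π (std v κ x) = std v κ (std w π x) := by
  rw [← end_mul_apply, ← end_mul_apply, std_mul, std_mul, hw.append_comm hv, std_apply, std_apply]
  congr 1
  refine List.map_congr_left fun a ha => ?_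
  obtain ⟨i, rfl⟩ := hx a ha
  exact hw.perm_comm hv i

theorem length_pow_std_le (hw : IsDirective W w π) (hv : IsDirective W v κ) {c k : ℕ}
    (h : k * v.length ≤ c * w.length) {x : FreeMonoid A}
    (hx : ∀ a ∈ x.toList, a ∈ Set.range W) :
    ((std v κ ^ k) x).length ≤ ((std w π ^ c) x).length := by
  have hpre : powWord v κ k <+: powWord w π c := by
    rw [hw.powWord_eq, hv.powWord_eq]
    obtain ⟨d, hd⟩ := Nat.exists_eq_add_of_le h
    rw [hd, List.range_add, List.map_append]
    exact List.prefix_append _ _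
  obtain ⟨y, μ, -, hY⟩ := exists_std_factor hpre (π ^ c) (κ ^ k)
  rw [← std_pow, ← std_pow] at hY
  have hcomm : (std v κ ^ k) ((std w π ^ c) x) = (std w π ^ c) ((std v κ ^ k) x) :=
    pow_apply_comm (Q := fun x => ∀ a ∈ x.toList, a ∈ Set.range W)
      (fun x hx => hv.std_mem_range hx)
      (fun x hx => (pow_apply_comm (Q := fun x => ∀ a ∈ x.toList, a ∈ Set.range W)
        (fun x hx => hw.std_mem_range hx) (fun x hx => hw.std_comm hv hx) c x hx).symm) k x hx
  rw [hY, end_mul_apply, end_mul_apply, std_pow] at hcomm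
  -- Write `S^c = T^k ∘ Y`. Commutation and injectivity of `T^k` give `S^c(x) = Y(T^k(x))`, and `Y`
  -- does not shorten words.
  rw [hY, end_mul_apply, std_pow, std_injective _ _ hcomm]
  exact length_le_length_std _ _ _

theorem sum_length_lt (hw : IsDirective W w π) (hv : IsDirective W v κ) {n m : ℕ} (hm : 1 ≤ m)
    (hnm : m ≤ n) (hlen : n * w.length = m * v.length) {p q : FreeMonoid A}
    (hp : ∀ a ∈ p.toList, a ∈ Set.range W)
    (hlt : ∀ j, ((std v κ ^ j) q).length < ((std v κ ^ j) p).length) :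
    ∑ j ∈ Finset.range m, ((std v κ ^ j) q).length <
      ∑ i ∈ Finset.range n, ((std w π ^ i) p).length := by
  have hwv : w.length ≤ v.length := by
    by_contra! h
    nlinarith
  calc
    _ < ∑ j ∈ Finset.range m, ((std v κ ^ j) p).length :=
      Finset.sum_lt_sum_of_nonempty (Finset.nonempty_range_iff.2 (by lia)) fun j _ => hlt j
    _ = ∑ j ∈ Finset.range m, ((std v κ ^ (m - 1 - j)) p).length :=
      (Finset.sum_range_reflect (fun j => ((std v κ ^ j) p).length) m).symm
    _ ≤ ∑ j ∈ Finset.range m, ((std w π ^ (n - 1 - j)) p).length := by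
      -- Exponents are matched from the top: `(m-1-j)|v| ≤ (n-1-j)|w|`, since `n|w| = m|v|` and `|w|
      -- ≤ |v|`.
      refine Finset.sum_le_sum fun j _ => hw.length_pow_std_le hv ?_ hp
      rw [Nat.sub_sub, Nat.sub_sub, Nat.sub_mul, Nat.sub_mul, hlen]
      exact Nat.sub_le_sub_left (Nat.mul_le_mul_left _ hwv) _
    _ ≤ ∑ j ∈ Finset.range n, ((std w π ^ (n - 1 - j)) p).length :=
      Finset.sum_le_sum_of_subset (Finset.range_mono hnm)
    _ = _ := Finset.sum_range_reflect (fun j => ((std w π ^ j) p).length) n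

/-- If `std w π` and `std v κ` have a common power, then the factorizations `pal w = p * p'` and
`pal v = q * q'` given by episturmian substitutions with this common power are comparable. -/
theorem length_le_of_orbitWord (hw : IsDirective W w π) (hv : IsDirective W v κ) {n m : ℕ}
    (hm : 1 ≤ m) (hnm : m ≤ n) (hpow : powWord w π n = powWord v κ m) (hwv : w <+: v)
    {p p' q q' : FreeMonoid A} (hp : pal w = p * p') (hq : pal v = q * q')
    (h : orbitWord (std w π) p n = orbitWord (std v κ) q m) :
    p.length ≤ q.length ∧ p'.length ≤ q'.length := by
  have hlen : n * w.length = m * v.length := by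
    rw [← length_powWord w π, hpow, length_powWord]
  have hmem : ∀ a ∈ (pal w).toList, a ∈ Set.range W := fun a ha => hw.mem_range (mem_pal ha)
  rw [hp] at hmem
  have hsum := congrArg FreeMonoid.length h
  have hsum' := congrArg (fun x => (pal x).length) hpow
  simp only [pal_powWord, length_orbitWord, hp, hq, map_mul, length_mul,
    Finset.sum_add_distrib] at hsum hsum'
  obtain ⟨r, rfl⟩ := hwv
  constructor
  · by_contra! hlt
    have hpv : p ∣ pal (w ++ r) := Dvd.dvd.trans ⟨p', hp⟩ (pal_dvd_pal_append w r)
    obtain ⟨e, rfl⟩ := dvd_of_dvd_of_length_le ⟨q', hq⟩ hpv hlt.le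
    refine (hw.sum_length_lt hv hm hnm hlen
      (fun a ha => hmem a (List.mem_append_left _ ha)) fun j => ?_).ne' hsum
    rw [map_mul, length_mul]
    rw [length_mul] at hlt
    have := length_pow_std_pos (w ++ r) κ j (x := e) (by lia)
    lia
  · by_contra! hlt
    have he : q * q' = psiWord w (pal r) * p * p' := by rw [← hq, pal_append, hp, mul_assoc]
    have hl := congrArg FreeMonoid.length he
    rw [length_mul, length_mul _ p'] at hl
    obtain ⟨e, rfl⟩ := dvd_of_dvd_of_length_le (z := q * q') ⟨p', he⟩ ⟨q', rfl⟩ (by lia)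
    have hep : e * q' = p' := mul_left_cancel (by rw [← mul_assoc]; exact he)
    subst hep
    -- Subtracting the equality for `p`, `q` from the one for `pal w`, `pal v` leaves the equality
    -- for `p'`, `q'`.
    refine (hw.sum_length_lt hv hm hnm hlen (q := q')
      (fun a ha => hmem a (List.mem_append_right _ ha)) fun j => ?_).ne' (by lia)
    rw [map_mul, length_mul]
    rw [length_mul] at hlt
    have := length_pow_std_pos (w ++ r) κ j (x := e) (by lia)
    lia

end IsDirective

/-! ### The left quotient of `τ` by `σ` -/

theorem exists_comp_eq_of_pow_eq_pow [Finite A] [Nontrivial A] {σ τ : Monoid.End (FreeMonoid A)}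
    (hσ : IsEpisturmian σ) (hτ : IsEpisturmian τ) {n m : ℕ} (hm : 1 ≤ m) (hnm : m ≤ n)
    (h : σ ^ n = τ ^ m) : ∃ ρ, IsEpisturmian ρ ∧ τ = σ * ρ := by
  obtain ⟨w, π, p, hp, hcσ⟩ := hσ.exists_isConjBy
  obtain ⟨v, κ, q, hq, hcτ⟩ := hτ.exists_isConjBy
  have hcn := hcσ.pow n
  have hcm := hcτ.pow m
  rw [std_pow] at hcn
  rw [← h, std_pow] at hcm
  obtain ⟨hpow, hperm⟩ := hcn.eq_of_std hcm
  have hST : std w π ^ n = std v κ ^ m := by rw [std_pow, std_pow, hpow, hperm]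
  have horb : orbitWord (std w π) p n = orbitWord (std v κ) q m := by
    rw [← hpow, ← hperm] at hcm
    exact hcn.unique (std_injective _ _) hcm (orbitWord_dvd_pal π hp n)
      (hpow ▸ orbitWord_dvd_pal κ hq m)
  have hlen : n * w.length = m * v.length := by
    rw [← length_powWord w π, hpow, length_powWord]
  have hwv : w <+: v := by
    obtain ⟨n, rfl⟩ := Nat.exists_eq_succ_of_ne_zero (by lia : n ≠ 0)
    obtain ⟨m, rfl⟩ := Nat.exists_eq_succ_of_ne_zero (by lia : m ≠ 0)
    refine List.prefix_of_prefix_length_le (l₃ := powWord w π (n + 1)) (List.prefix_append _ _)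
      (hpow ▸ List.prefix_append _ _) ?_
    by_contra! h
    nlinarith
  obtain ⟨p', hp'⟩ := hp
  obtain ⟨q', hq'⟩ := hq
  have hle : p.length ≤ q.length ∧ p'.length ≤ q'.length := by
    by_cases hw : w = []
    -- An empty `w` directs no infinite word, but then `p` and `p'` are empty.
    · have := congrArg FreeMonoid.length hp'
      rw [hw, pal_nil, length_one, length_mul] at this
      lia
    · have hw0 : 0 < n * w.length :=
        Nat.mul_pos (by lia) (List.length_pos_iff.2 hw)
      have hv : v ≠ [] := by
        rintro rfl
        simp [hlen] at hw0
      obtain ⟨W, hW⟩ := exists_isDirective hw π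
      obtain ⟨V, hV⟩ := exists_isDirective hv κ
      obtain rfl : W = V := hW.eq_of_powWord (n := n) (m := m) hV hw0 fun k =>
        (eq_of_std_eq (by rw [← std_pow, ← std_pow, pow_mul, pow_mul, hST])).1
      exact hW.length_le_of_orbitWord hV hm hnm hpow hwv hp' hq' horb
  obtain ⟨y, μ, rfl, hT⟩ := exists_std_factor hwv κ π
  obtain ⟨n, rfl⟩ := Nat.exists_eq_succ_of_ne_zero (by lia : n ≠ 0)
  obtain ⟨m, rfl⟩ := Nat.exists_eq_succ_of_ne_zero (by lia : m ≠ 0)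
  set v := w ++ y.map π with hv
  set r := orbitWord (std w π) p n
  set s := orbitWord (std v κ) q m
  have horb : std w π r * p = std w π (std y μ s) * q := by
    rw [← end_mul_apply, ← hT]; exact horb
  have hdir : powWord w π n = y ++ (powWord v κ m).map μ := by
    refine (eq_of_std_eq (π := π ^ n) (κ := μ * κ ^ m) ?_).1
    rw [← std_pow, ← std_mul, ← std_pow]
    refine DFunLike.ext _ _ fun x => std_injective w π ?_
    rw [← end_mul_apply, ← end_mul_apply, ← mul_assoc, ← hT, ← pow_succ', ← pow_succ', hST]
  have hr : r ∣ pal (powWord w π n) := orbitWord_dvd_pal π ⟨p', hp'⟩ n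
  have hs : std y μ s * pal y ∣ pal (powWord w π n) :=
    hdir ▸ std_mul_dvd_pal μ dvd_rfl (orbitWord_dvd_pal κ ⟨q', hq'⟩ m)
  have hl := congrArg FreeMonoid.length horb
  rw [length_mul, length_mul] at hl
  obtain ⟨t, ht⟩ : std y μ s ∣ r :=
    dvd_of_dvd_of_length_std_le (w := w) (π := π) ((dvd_mul_right _ _).trans hs) hr (by lia)
  have hty : t ∣ pal y := by
    -- By `pal v = S(pal y) p p' = q q'`, the bound `|p'| ≤ |q'|` says `|S(pal y)| ≥ |q| - |p|`.
    obtain ⟨c, hc⟩ : r ∣ std y μ s * pal y := by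
      refine dvd_of_dvd_of_length_std_le (w := w) (π := π) hr hs ?_
      have := congrArg FreeMonoid.length hq'
      rw [pal_append_map, hp', length_mul, length_mul, length_mul] at this
      rw [map_mul, length_mul]
      lia
    rw [ht, mul_assoc] at hc
    exact ⟨c, mul_left_cancel hc⟩
  have hqt : q = std w π t * p := by
    rw [ht, map_mul, mul_assoc] at horb
    exact (mul_left_cancel horb).symm
  obtain ⟨ρ, hρ, hcρ⟩ := exists_isEpisturmian_isConjBy μ hty
  refine ⟨ρ, hρ, DFunLike.ext _ _ fun x => mul_left_cancel (a := q) ?_⟩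
  have := hcσ.mul hcρ x
  rw [← hT, ← hqt] at this
  rw [hcτ, this]

end

end Episturmian

theorem lemma3p5 {A : Type*} [Finite A] [DecidableEq A]
    (σ τ : Monoid.End (FreeMonoid A))
    (hσ : Episturmian.IsEpisturmian σ) (hτ : Episturmian.IsEpisturmian τ)
    (n m : ℕ) (hm : 1 ≤ m) (hnm : m ≤ n) (h : σ ^ n = τ ^ m) :
    ∃ ρ : Monoid.End (FreeMonoid A), Episturmian.IsEpisturmian ρ ∧ τ = MonoidHom.comp σ ρ := by
  -- With at most one letter the standard form is not unique, but every episturmian substitution is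
  -- the identity.
  rcases subsingleton_or_nontrivial A with hA | hA
  · have one : ∀ f : Monoid.End (FreeMonoid A), Episturmian.IsEpisturmian f → f = 1 := by
      intro f hf
      induction hf using Submonoid.closure_induction with
      | mem f hf =>
        refine FreeMonoid.hom_eq fun b => ?_
        rcases hf with (⟨a, c, rfl⟩ | ⟨a, rfl⟩) | ⟨a, rfl⟩
        · exact congrArg FreeMonoid.of (Subsingleton.elim _ _)
        · refine (Episturmian.psi_of a b).trans ?_
          rw [if_pos (Subsingleton.elim _ _), Subsingleton.elim b a]; rfl
        · refine (Episturmian.psiBar_of a b).trans ?_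
          rw [if_pos (Subsingleton.elim _ _), Subsingleton.elim b a]; rfl
      | one => rfl
      | mul f g _ _ hf hg => rw [hf, hg, one_mul]
    refine ⟨1, one_mem _, ?_⟩
    rw [one σ hσ, one τ hτ]
    rfl
  · exact Episturmian.exists_comp_eq_of_pow_eq_pow hσ hτ hm hnm h
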